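/- Call a $6\times 2n$ matrix with entries in $\{0,1\}$ balanced if every row contains exactly $n$ ones (hence exactly $n$ zeros) and every column contains exactly $3$ ones (hence exactly $3$ zeros), and let $a(n)$ be the number of balanced $6\times 2n$ 0-1 matrices. Then for every integer $n\ge 0$ (with $a(0)=1$, counting the empty matrix), $$ \begin{aligned} & 51200 (2n+7)(2n+5)(2n+3)(2n+1)(n+2)(n+1)\bigl(33n^{2}+242n+445\bigr)\,a(n)\\ & - 128 (2n+7)(2n+5)(2n+3)(n+2)\bigl(7491n^{4}+84898n^{3}+351364n^{2}+628997n+414370\bigr)\,a(n+1)\\ & + 16 (2n+5)(2n+7)\bigl(2772n^{6}+48048n^{5}+344379n^{4}+1307394n^{3}+2775099n^{2}+3125336n+1460132\bigr)\,a(n+2)\\ & + 2 (2n+7)(n+3)\bigl(3201n^{6}+61886n^{5}+497179n^{4}+2124170n^{3}+5089654n^{2}+6484024n+3431096\bigr)\,a(n+3)\\ & - (n+3)(n+4)^5\bigl(33n^{2}+176n+236\bigr)\,a(n+4) = 0 . \end{aligned} $$ -/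

import Mathlib

/-- A 0-1 matrix with `2k` rows and `2n` columns is balanced if every row has exactly `n` ones
(hence exactly `n` zeros) and every column has exactly `k` ones (hence exactly `k` zeros). -/
def IsBalanced (k n : ℕ) (A : Matrix (Fin (2 * k)) (Fin (2 * n)) (Fin 2)) : Prop :=
  (∀ i, (Finset.univ.filter fun j => A i j = 1).card = n) ∧
    (∀ j, (Finset.univ.filter fun i => A i j = 1).card = k)

/-- The number of balanced `2k × 2n` 0-1 matrices. -/
noncomputable def balancedCount (k n : ℕ) : ℕ :=
  Nat.card {A : Matrix (Fin (2 * k)) (Fin (2 * n)) (Fin 2) // IsBalanced k n A}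

namespace MvPolynomial

open Finset

/-! Reading a balanced matrix column by column shows that a(n) is the coefficient of (x₁⋯x₆)^n in
e₃^(2n), where eⱼ are the elementary symmetric polynomials in six variables
(`balancedCount_eq_coeff`). It is one of a family of moments: coefficients of (x₁⋯x₆)^N in monomials
in e₁, …, e₅.

Two sources of linear relations among moments are used. Symmetric vector fields tangent to the
coordinate hyperplanes give integration by parts (`coeff_esymmField`), and xᵢ ↦ xᵢ⁻¹ exchanges eⱼ
and e₆₋ⱼ (`esymmMoment_reverse`). Eighteen such relations, after elimination of the auxiliary
moments, express four particular moments at n + 1, among them a(n + 1), as combinations of the same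
four at n, with coefficients rational in n (`cubicMoment_transition`).

Iterating, a(n), …, a(n + 4) are five vectors in a space of dimension four over ℚ(n), hence
dependent. The recurrence is such a dependency, verified as an identity of rational functions. -/

theorem isHomogeneous_esymm (σ R : Type*) [Fintype σ] [CommRing R] (k : ℕ) :
    (esymm σ R k).IsHomogeneous k := by
  refine IsHomogeneous.sum _ _ _ fun t ht => ?_
  rw [← (mem_powersetCard.1 ht).2, card_eq_sum_ones]
  exact IsHomogeneous.prod _ _ _ fun i _ => isHomogeneous_X R i

theorem coeff_X_mul_pderiv {σ R : Type*} [CommRing R] (i : σ) (f : MvPolynomial σ R)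
    (κ : σ →₀ ℕ) :
    coeff κ (X i * pderiv i f) = κ i * coeff κ f := by
  classical
  induction f using MvPolynomial.induction_on' with
  | add p q hp hq => simp only [map_add, mul_add, coeff_add, hp, hq]
  | monomial m a =>
    rw [X_mul_pderiv_monomial, coeff_smul, coeff_monomial]
    split_ifs with h
    · rw [h, nsmul_eq_mul]
    · simp

/-! ### Symmetric vector fields and integration by parts. -/

section EsymmErase

variable {σ R : Type*} [Fintype σ] [DecidableEq σ] [CommRing R]

/-- The `k`th elementary symmetric polynomial in the variables other than `i`. -/
noncomputable def esymmErase (R : Type*) [CommRing R] (i : σ) (k : ℕ) : MvPolynomial σ R :=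
  ∑ t ∈ powersetCard k (univ.erase i), ∏ j ∈ t, X j

theorem esymmErase_zero (i : σ) : esymmErase R i 0 = 1 := by
  simp [esymmErase]

theorem esymm_succ_eq_esymmErase (i : σ) (k : ℕ) :
    esymm σ R (k + 1) = esymmErase R i (k + 1) + X i * esymmErase R i k := by
  have hi : i ∉ univ.erase i := notMem_erase i univ
  rw [esymm, ← insert_erase (mem_univ i), powersetCard_succ_insert hi, sum_union, sum_image,
    esymmErase, esymmErase, mul_sum]
  · congr 1
    refine sum_congr rfl fun t ht => ?_
    exact prod_insert fun h => hi ((mem_powersetCard.1 ht).1 h)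
  · intro s hs t ht h
    have hs' : i ∉ s := fun h => hi ((mem_powersetCard.1 hs).1 h)
    have ht' : i ∉ t := fun h => hi ((mem_powersetCard.1 ht).1 h)
    rw [← erase_insert hs', ← erase_insert ht', h]
  · rw [disjoint_left]
    intro s hs h
    obtain ⟨t, -, rfl⟩ := mem_image.1 h
    exact hi ((mem_powersetCard.1 hs).1 (mem_insert_self i t))

theorem pderiv_esymmErase (i : σ) (k : ℕ) : pderiv i (esymmErase R i k) = 0 := by
  rw [esymmErase, map_sum]
  refine sum_eq_zero fun t ht => ?_
  refine prod_induction _ (fun p => pderiv i p = 0) (fun p q hp hq => ?_) (pderiv i).map_one_eq_zero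
    fun j hj => ?_
  · rw [pderiv_mul, hp, hq]; simp
  · exact pderiv_X_of_ne (ne_of_mem_erase ((mem_powersetCard.1 ht).1 hj))

theorem pderiv_esymm_succ (i : σ) (k : ℕ) :
    pderiv i (esymm σ R (k + 1)) = esymmErase R i k := by
  rw [esymm_succ_eq_esymmErase i, map_add, pderiv_mul, pderiv_esymmErase, pderiv_esymmErase]
  simp

theorem sum_X_mul_esymmErase (k : ℕ) :
    ∑ i : σ, X i * esymmErase R i k = (k + 1 : MvPolynomial σ R) * esymm σ R (k + 1) := by
  have h := (isHomogeneous_esymm σ R (k + 1)).sum_X_mul_pderiv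
  simp_rw [pderiv_esymm_succ, nsmul_eq_mul] at h
  rw [h]; push_cast; ring

/-- Each k-subset is counted once for every variable that it omits. This is the divergence factor in
`coeff_esymmField`. -/
theorem sum_esymmErase (k : ℕ) :
    ∑ i : σ, esymmErase R i k = ((Fintype.card σ : MvPolynomial σ R) - k) * esymm σ R k := by
  cases k with
  | zero => simp [esymmErase_zero]
  | succ k =>
    have h : ∀ i : σ, esymmErase R i (k + 1) = esymm σ R (k + 1) - X i * esymmErase R i k :=
      fun i => by rw [esymm_succ_eq_esymmErase i]; ring
    simp_rw [h, sum_sub_distrib, sum_X_mul_esymmErase]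
    simp
    ring

/-- The vector field `∑ i, X i * esymmErase i l * ∂/∂X i`; together these generate the symmetric
vector fields tangent to the coordinate hyperplanes. -/
noncomputable def esymmField (σ R : Type*) [Fintype σ] [DecidableEq σ] [CommRing R] (l : ℕ) :
    Derivation R (MvPolynomial σ R) (MvPolynomial σ R) :=
  mkDerivation R fun i => X i * esymmErase R i l

theorem esymmField_apply (l : ℕ) (f : MvPolynomial σ R) :
    esymmField σ R l f = ∑ i, X i * esymmErase R i l * pderiv i f := by
  have h : esymmField σ R l = ∑ i, (X i * esymmErase R i l) • pderiv i := by
    refine derivation_ext fun j => ?_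
    rw [esymmField, mkDerivation_X, ← Derivation.coeFnAddMonoidHom_apply, map_sum, Finset.sum_apply,
      sum_eq_single j]
    · simp
    · intro i _ hij
      simp [hij.symm]
    · simp
  rw [h, ← Derivation.coeFnAddMonoidHom_apply, map_sum, Finset.sum_apply]
  rfl

theorem esymmField_esymm_one (l : ℕ) :
    esymmField σ R l (esymm σ R 1) = (l + 1 : MvPolynomial σ R) * esymm σ R (l + 1) := by
  simp_rw [esymmField_apply, pderiv_esymm_succ, esymmErase_zero, mul_one, sum_X_mul_esymmErase]

/-- Expanding eⱼ₊₁ by its dependence on one variable makes the cross terms cancel. Iteration lowers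
the argument to e₁, so every field applied to every eⱼ is a quadratic polynomial in the elementary
symmetric polynomials. -/
theorem esymmField_esymm_add_two (l k : ℕ) :
    esymmField σ R l (esymm σ R (k + 2)) = esymmField σ R (l + 1) (esymm σ R (k + 1))
      + ((l : MvPolynomial σ R) - k) * (esymm σ R (l + 1) * esymm σ R (k + 1)) := by
  have h : ∀ i : σ, X i * esymmErase R i l * esymmErase R i (k + 1)
      = X i * esymmErase R i (l + 1) * esymmErase R i k
        + (esymm σ R (k + 1) * (X i * esymmErase R i l)
          - esymm σ R (l + 1) * (X i * esymmErase R i k)) := fun i => by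
    rw [esymm_succ_eq_esymmErase i l, esymm_succ_eq_esymmErase i k]; ring
  simp_rw [esymmField_apply, pderiv_esymm_succ, h, sum_add_distrib, sum_sub_distrib, ← mul_sum,
    sum_X_mul_esymmErase]
  ring

/-- Integration by parts for the coefficient of `(∏ i, X i) ^ N`. -/
theorem coeff_esymmField (l N : ℕ) (f : MvPolynomial σ R) (κ : σ →₀ ℕ) (hκ : ∀ i, κ i = N) :
    coeff κ (esymmField σ R l f)
      = N * ((Fintype.card σ : R) - l) * coeff κ (esymm σ R l * f) := by
  -- The factor `esymmErase R i l` is free of the i-th variable, so it passes under ∂ᵢ; the operator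
  -- xᵢ∂ᵢ then just multiplies the coefficient by N.
  have h : ∀ i, X i * esymmErase R i l * pderiv i f = X i * pderiv i (esymmErase R i l * f) :=
    fun i => by rw [pderiv_mul, pderiv_esymmErase]; ring
  simp_rw [esymmField_apply, h, coeff_sum, coeff_X_mul_pderiv, hκ, ← mul_sum, ← coeff_sum,
    ← sum_mul, sum_esymmErase]
  have hC : (Fintype.card σ : MvPolynomial σ R) - (l : MvPolynomial σ R)
      = C ((Fintype.card σ : R) - (l : R)) := by simp
  rw [hC, mul_assoc, coeff_C_mul, mul_assoc]

end EsymmErase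

/-! ### Moments in six variables and their integration-by-parts relations. -/

theorem esymm_eq_zero_of_card_lt {σ R : Type*} [Fintype σ] [CommRing R] {k : ℕ}
    (h : Fintype.card σ < k) : esymm σ R k = 0 := by
  rw [esymm, powersetCard_eq_empty.2 (by simpa using h), sum_empty]

theorem esymm_card {σ R : Type*} [Fintype σ] [CommRing R] :
    esymm σ R (Fintype.card σ) = ∏ i, X i := by
  rw [esymm, ← card_univ, powersetCard_self, sum_singleton]

/-- The constant exponent vector. -/
noncomputable def constExponent (N : ℕ) : Fin 6 →₀ ℕ :=
  Finsupp.equivFunOnFinite.symm fun _ => N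

@[simp]
theorem constExponent_apply (N : ℕ) (i : Fin 6) : constExponent N i = N := rfl

/-- The coefficient of `(x₁ ⋯ x₆) ^ N` in `e₁ ^ a * e₂ ^ b * e₃ ^ c * e₄ ^ d * e₅ ^ e`. -/
noncomputable def esymmMoment (N a b c d e : ℕ) : ℚ :=
  coeff (constExponent N) (esymm (Fin 6) ℚ 1 ^ a * esymm (Fin 6) ℚ 2 ^ b * esymm (Fin 6) ℚ 3 ^ c
    * esymm (Fin 6) ℚ 4 ^ d * esymm (Fin 6) ℚ 5 ^ e)

/-- Since e₆ = x₁⋯x₆, a factor e₆ only shifts N; this is why `esymmMoment` has no exponent for e₆.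
-/
theorem coeff_esymm_six_mul (N : ℕ) (f : MvPolynomial (Fin 6) ℚ) :
    coeff (constExponent (N + 1)) (esymm (Fin 6) ℚ 6 * f) = coeff (constExponent N) f := by
  have h : esymm (Fin 6) ℚ 6 = monomial (constExponent 1) 1 := by
    have h6 := esymm_card (σ := Fin 6) (R := ℚ)
    rw [Fintype.card_fin] at h6
    rw [h6, monomial_eq, Finsupp.prod_fintype _ _ (by simp)]
    simp
  have hN : constExponent (N + 1) = constExponent 1 + constExponent N := by
    ext i; simp [add_comm]
  rw [h, hN, coeff_monomial_mul, one_mul]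

/-- Truncated subtraction in a derivative's exponent is harmless: when a = 0 the coefficient a kills
the term. -/
theorem natCast_mul_pow_pred_mul {A : Type*} [CommRing A] (x : A) (a : ℕ) :
    (a : A) * x ^ (a - 1) * x = a * x ^ a := by
  cases a with
  | zero => simp
  | succ a => rw [Nat.add_sub_cancel, pow_succ]; ring

theorem derivation_mul_pow_five {A : Type*} [CommRing A] [Algebra ℚ A] (D : Derivation ℚ A A)
    (x y z t u : A) (a b c d e : ℕ) :
    D (x ^ a * y ^ b * z ^ c * t ^ d * u ^ e)
      = a * x ^ (a - 1) * D x * (y ^ b * z ^ c * t ^ d * u ^ e)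
        + b * y ^ (b - 1) * D y * (x ^ a * z ^ c * t ^ d * u ^ e)
        + c * z ^ (c - 1) * D z * (x ^ a * y ^ b * t ^ d * u ^ e)
        + d * t ^ (d - 1) * D t * (x ^ a * y ^ b * z ^ c * u ^ e)
        + e * u ^ (e - 1) * D u * (x ^ a * y ^ b * z ^ c * t ^ d) := by
  simp only [Derivation.leibniz, Derivation.leibniz_pow, smul_eq_mul, nsmul_eq_mul]
  ring

/-- Integration by parts for `esymmMoment` along the field `esymmField` with index one. -/
theorem esymmMoment_field_one (N a b c d e : ℕ) :
    a * (2 * esymmMoment (N + 1) (a - 1) (b + 1) c d e)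
      + b * (esymmMoment (N + 1) (a + 1) b c d e
        + 3 * esymmMoment (N + 1) a (b - 1) (c + 1) d e)
      + c * (2 * esymmMoment (N + 1) (a + 1) b c d e
        + 4 * esymmMoment (N + 1) a b (c - 1) (d + 1) e)
      + d * (3 * esymmMoment (N + 1) (a + 1) b c d e
        + 5 * esymmMoment (N + 1) a b c (d - 1) (e + 1))
      + e * (4 * esymmMoment (N + 1) (a + 1) b c d e
        + 6 * esymmMoment N a b c d (e - 1))
      = 5 * (N + 1) * esymmMoment (N + 1) (a + 1) b c d e := by
  have h1 : esymmField (Fin 6) ℚ 1 (esymm (Fin 6) ℚ 1) =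
      2 * esymm (Fin 6) ℚ 2 := by
    rw [esymmField_esymm_one 1]
    norm_num
  have h2 : esymmField (Fin 6) ℚ 1 (esymm (Fin 6) ℚ 2) =
      (esymm (Fin 6) ℚ 1 * esymm (Fin 6) ℚ 2) + 3 * esymm (Fin 6) ℚ 3 := by
    rw [esymmField_esymm_add_two 1 0, esymmField_esymm_one 2]
    norm_num
    ring
  have h3 : esymmField (Fin 6) ℚ 1 (esymm (Fin 6) ℚ 3) =
      2 * (esymm (Fin 6) ℚ 1 * esymm (Fin 6) ℚ 3) + 4 * esymm (Fin 6) ℚ 4 := by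
    rw [esymmField_esymm_add_two 1 1, esymmField_esymm_add_two 2 0, esymmField_esymm_one 3]
    norm_num
    ring
  have h4 : esymmField (Fin 6) ℚ 1 (esymm (Fin 6) ℚ 4) =
      3 * (esymm (Fin 6) ℚ 1 * esymm (Fin 6) ℚ 4) + 5 * esymm (Fin 6) ℚ 5 := by
    rw [esymmField_esymm_add_two 1 2, esymmField_esymm_add_two 2 1, esymmField_esymm_add_two 3 0,
      esymmField_esymm_one 4]
    norm_num
    ring
  have h5 : esymmField (Fin 6) ℚ 1 (esymm (Fin 6) ℚ 5) =
      4 * (esymm (Fin 6) ℚ 1 * esymm (Fin 6) ℚ 5) + 6 * esymm (Fin 6) ℚ 6 := by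
    rw [esymmField_esymm_add_two 1 3, esymmField_esymm_add_two 2 2, esymmField_esymm_add_two 3 1,
      esymmField_esymm_add_two 4 0, esymmField_esymm_one 5]
    norm_num
    ring
  have key := coeff_esymmField 1 (N + 1) (esymm (Fin 6) ℚ 1 ^ a * esymm (Fin 6) ℚ 2 ^ b
    * esymm (Fin 6) ℚ 3 ^ c * esymm (Fin 6) ℚ 4 ^ d * esymm (Fin 6) ℚ 5 ^ e)
    (constExponent (N + 1)) fun _ => rfl
  rw [derivation_mul_pow_five, h1, h2, h3, h4, h5] at key
  unfold esymmMoment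
  -- Moments at level N are raised to level N + 1 by inserting e₆, so that all terms are
  -- coefficients at one exponent.
  simp only [← coeff_esymm_six_mul N]
  generalize esymm (Fin 6) ℚ 1 = x1 at key ⊢
  generalize esymm (Fin 6) ℚ 2 = x2 at key ⊢
  generalize esymm (Fin 6) ℚ 3 = x3 at key ⊢
  generalize esymm (Fin 6) ℚ 4 = x4 at key ⊢
  generalize esymm (Fin 6) ℚ 5 = x5 at key ⊢
  generalize esymm (Fin 6) ℚ 6 = x6 at key ⊢
  have hl : x1 * (x1 ^ a * x2 ^ b * x3 ^ c * x4 ^ d * x5 ^ e) =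
      x1 ^ (a + 1) * x2 ^ b * x3 ^ c * x4 ^ d * x5 ^ e := by ring
  have hsum :
      (a : MvPolynomial (Fin 6) ℚ) * x1 ^ (a - 1) * (2 * x2) * (x2 ^ b * x3 ^ c * x4 ^ d * x5 ^ e)
        + (b : MvPolynomial (Fin 6) ℚ) * x2 ^ (b - 1) * ((x1 * x2) + 3 * x3) * (x1 ^ a * x3 ^ c
          * x4 ^ d * x5 ^ e)
        + (c : MvPolynomial (Fin 6) ℚ) * x3 ^ (c - 1) * (2 * (x1 * x3) + 4 * x4) * (x1 ^ a
          * x2 ^ b * x4 ^ d * x5 ^ e)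
        + (d : MvPolynomial (Fin 6) ℚ) * x4 ^ (d - 1) * (3 * (x1 * x4) + 5 * x5) * (x1 ^ a
          * x2 ^ b * x3 ^ c * x5 ^ e)
        + (e : MvPolynomial (Fin 6) ℚ) * x5 ^ (e - 1) * (4 * (x1 * x5) + 6 * x6) * (x1 ^ a
          * x2 ^ b * x3 ^ c * x4 ^ d)
      = C (2 * (a : ℚ)) * (x1 ^ (a - 1) * x2 ^ (b + 1) * x3 ^ c * x4 ^ d * x5 ^ e)
        + C (1 * (b : ℚ)) * (x1 ^ (a + 1) * x2 ^ b * x3 ^ c * x4 ^ d * x5 ^ e)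
        + C (3 * (b : ℚ)) * (x1 ^ a * x2 ^ (b - 1) * x3 ^ (c + 1) * x4 ^ d * x5 ^ e)
        + C (2 * (c : ℚ)) * (x1 ^ (a + 1) * x2 ^ b * x3 ^ c * x4 ^ d * x5 ^ e)
        + C (4 * (c : ℚ)) * (x1 ^ a * x2 ^ b * x3 ^ (c - 1) * x4 ^ (d + 1) * x5 ^ e)
        + C (3 * (d : ℚ)) * (x1 ^ (a + 1) * x2 ^ b * x3 ^ c * x4 ^ d * x5 ^ e)
        + C (5 * (d : ℚ)) * (x1 ^ a * x2 ^ b * x3 ^ c * x4 ^ (d - 1) * x5 ^ (e + 1))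
        + C (4 * (e : ℚ)) * (x1 ^ (a + 1) * x2 ^ b * x3 ^ c * x4 ^ d * x5 ^ e)
        + C (6 * (e : ℚ)) * x6 * (x1 ^ a * x2 ^ b * x3 ^ c * x4 ^ d * x5 ^ (e - 1)) := by
    simp only [map_mul, map_natCast, map_ofNat, map_one]
    linear_combination x1 * (x1 ^ a * x3 ^ c * x4 ^ d * x5 ^ e) * natCast_mul_pow_pred_mul x2 b
      + 2 * x1 * (x1 ^ a * x2 ^ b * x4 ^ d * x5 ^ e) * natCast_mul_pow_pred_mul x3 c
      + 3 * x1 * (x1 ^ a * x2 ^ b * x3 ^ c * x5 ^ e) * natCast_mul_pow_pred_mul x4 d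
      + 4 * x1 * (x1 ^ a * x2 ^ b * x3 ^ c * x4 ^ d) * natCast_mul_pow_pred_mul x5 e
  rw [hsum, hl] at key
  simp only [coeff_add, coeff_C_mul, mul_assoc (C _)] at key
  simp at key
  linear_combination key

theorem esymmMoment_field_two (N a b c d e : ℕ) :
    a * (3 * esymmMoment (N + 1) (a - 1) b (c + 1) d e)
      + b * (2 * esymmMoment (N + 1) (a + 1) (b - 1) (c + 1) d e
        + 4 * esymmMoment (N + 1) a (b - 1) c (d + 1) e)
      + c * (esymmMoment (N + 1) a (b + 1) c d e
        + 3 * esymmMoment (N + 1) (a + 1) b (c - 1) (d + 1) e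
        + 5 * esymmMoment (N + 1) a b (c - 1) d (e + 1))
      + d * (2 * esymmMoment (N + 1) a (b + 1) c d e
        + 4 * esymmMoment (N + 1) (a + 1) b c (d - 1) (e + 1)
        + 6 * esymmMoment N a b c (d - 1) e)
      + e * (3 * esymmMoment (N + 1) a (b + 1) c d e
        + 5 * esymmMoment N (a + 1) b c d (e - 1))
      = 4 * (N + 1) * esymmMoment (N + 1) a (b + 1) c d e := by
  have h1 : esymmField (Fin 6) ℚ 2 (esymm (Fin 6) ℚ 1) =
      3 * esymm (Fin 6) ℚ 3 := by
    rw [esymmField_esymm_one 2]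
    norm_num
  have h2 : esymmField (Fin 6) ℚ 2 (esymm (Fin 6) ℚ 2) =
      2 * (esymm (Fin 6) ℚ 1 * esymm (Fin 6) ℚ 3) + 4 * esymm (Fin 6) ℚ 4 := by
    rw [esymmField_esymm_add_two 2 0, esymmField_esymm_one 3]
    norm_num
    ring
  have h3 : esymmField (Fin 6) ℚ 2 (esymm (Fin 6) ℚ 3) =
      (esymm (Fin 6) ℚ 2 * esymm (Fin 6) ℚ 3) + 3 * (esymm (Fin 6) ℚ 1 * esymm (Fin 6) ℚ 4) + 5
        * esymm (Fin 6) ℚ 5 := by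
    rw [esymmField_esymm_add_two 2 1, esymmField_esymm_add_two 3 0, esymmField_esymm_one 4]
    norm_num
    ring
  have h4 : esymmField (Fin 6) ℚ 2 (esymm (Fin 6) ℚ 4) =
      2 * (esymm (Fin 6) ℚ 2 * esymm (Fin 6) ℚ 4) + 4 * (esymm (Fin 6) ℚ 1 * esymm (Fin 6) ℚ 5)
        + 6 * esymm (Fin 6) ℚ 6 := by
    rw [esymmField_esymm_add_two 2 2, esymmField_esymm_add_two 3 1, esymmField_esymm_add_two 4 0,
      esymmField_esymm_one 5]
    norm_num
    ring
  have h5 : esymmField (Fin 6) ℚ 2 (esymm (Fin 6) ℚ 5) =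
      3 * (esymm (Fin 6) ℚ 2 * esymm (Fin 6) ℚ 5) + 5 * (esymm (Fin 6) ℚ 1 * esymm
        (Fin 6) ℚ 6) := by
    rw [esymmField_esymm_add_two 2 3, esymmField_esymm_add_two 3 2, esymmField_esymm_add_two 4 1,
      esymmField_esymm_add_two 5 0, esymmField_esymm_one 6]
    -- The descent to e₁ overshoots to e₇, which vanishes in six variables.
    norm_num [esymm_eq_zero_of_card_lt (σ := Fin 6) (R := ℚ) (k := 7) (by simp)]
    ring
  have key := coeff_esymmField 2 (N + 1) (esymm (Fin 6) ℚ 1 ^ a * esymm (Fin 6) ℚ 2 ^ b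
    * esymm (Fin 6) ℚ 3 ^ c * esymm (Fin 6) ℚ 4 ^ d * esymm (Fin 6) ℚ 5 ^ e)
    (constExponent (N + 1)) fun _ => rfl
  rw [derivation_mul_pow_five, h1, h2, h3, h4, h5] at key
  unfold esymmMoment
  simp only [← coeff_esymm_six_mul N]
  generalize esymm (Fin 6) ℚ 1 = x1 at key ⊢
  generalize esymm (Fin 6) ℚ 2 = x2 at key ⊢
  generalize esymm (Fin 6) ℚ 3 = x3 at key ⊢
  generalize esymm (Fin 6) ℚ 4 = x4 at key ⊢
  generalize esymm (Fin 6) ℚ 5 = x5 at key ⊢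
  generalize esymm (Fin 6) ℚ 6 = x6 at key ⊢
  have hl : x2 * (x1 ^ a * x2 ^ b * x3 ^ c * x4 ^ d * x5 ^ e) =
      x1 ^ a * x2 ^ (b + 1) * x3 ^ c * x4 ^ d * x5 ^ e := by ring
  have hsum :
      (a : MvPolynomial (Fin 6) ℚ) * x1 ^ (a - 1) * (3 * x3) * (x2 ^ b * x3 ^ c * x4 ^ d * x5 ^ e)
        + (b : MvPolynomial (Fin 6) ℚ) * x2 ^ (b - 1) * (2 * (x1 * x3) + 4 * x4) * (x1 ^ a
          * x3 ^ c * x4 ^ d * x5 ^ e)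
        + (c : MvPolynomial (Fin 6) ℚ) * x3 ^ (c - 1) * ((x2 * x3) + 3 * (x1 * x4) + 5 * x5) *
          (x1 ^ a * x2 ^ b * x4 ^ d * x5 ^ e)
        + (d : MvPolynomial (Fin 6) ℚ) * x4 ^ (d - 1) * (2 * (x2 * x4) + 4 * (x1 * x5) + 6 * x6) *
          (x1 ^ a * x2 ^ b * x3 ^ c * x5 ^ e)
        + (e : MvPolynomial (Fin 6) ℚ) * x5 ^ (e - 1) * (3 * (x2 * x5) + 5 * (x1 * x6)) * (x1 ^ a
          * x2 ^ b * x3 ^ c * x4 ^ d)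
      = C (3 * (a : ℚ)) * (x1 ^ (a - 1) * x2 ^ b * x3 ^ (c + 1) * x4 ^ d * x5 ^ e)
        + C (2 * (b : ℚ)) * (x1 ^ (a + 1) * x2 ^ (b - 1) * x3 ^ (c + 1) * x4 ^ d * x5 ^ e)
        + C (4 * (b : ℚ)) * (x1 ^ a * x2 ^ (b - 1) * x3 ^ c * x4 ^ (d + 1) * x5 ^ e)
        + C (1 * (c : ℚ)) * (x1 ^ a * x2 ^ (b + 1) * x3 ^ c * x4 ^ d * x5 ^ e)
        + C (3 * (c : ℚ)) * (x1 ^ (a + 1) * x2 ^ b * x3 ^ (c - 1) * x4 ^ (d + 1) * x5 ^ e)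
        + C (5 * (c : ℚ)) * (x1 ^ a * x2 ^ b * x3 ^ (c - 1) * x4 ^ d * x5 ^ (e + 1))
        + C (2 * (d : ℚ)) * (x1 ^ a * x2 ^ (b + 1) * x3 ^ c * x4 ^ d * x5 ^ e)
        + C (4 * (d : ℚ)) * (x1 ^ (a + 1) * x2 ^ b * x3 ^ c * x4 ^ (d - 1) * x5 ^ (e + 1))
        + C (6 * (d : ℚ)) * x6 * (x1 ^ a * x2 ^ b * x3 ^ c * x4 ^ (d - 1) * x5 ^ e)
        + C (3 * (e : ℚ)) * (x1 ^ a * x2 ^ (b + 1) * x3 ^ c * x4 ^ d * x5 ^ e)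
        + C (5 * (e : ℚ)) * x6 * (x1 ^ (a + 1) * x2 ^ b * x3 ^ c * x4 ^ d * x5 ^ (e - 1)) := by
    simp only [map_mul, map_natCast, map_ofNat, map_one]
    linear_combination x2 * (x1 ^ a * x2 ^ b * x4 ^ d * x5 ^ e) * natCast_mul_pow_pred_mul x3 c
      + 2 * x2 * (x1 ^ a * x2 ^ b * x3 ^ c * x5 ^ e) * natCast_mul_pow_pred_mul x4 d
      + 3 * x2 * (x1 ^ a * x2 ^ b * x3 ^ c * x4 ^ d) * natCast_mul_pow_pred_mul x5 e
  rw [hsum, hl] at key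
  simp only [coeff_add, coeff_C_mul, mul_assoc (C _)] at key
  simp at key
  linear_combination key

theorem esymmMoment_field_three (N a b c d e : ℕ) :
    a * (4 * esymmMoment (N + 1) (a - 1) b c (d + 1) e)
      + b * (3 * esymmMoment (N + 1) (a + 1) (b - 1) c (d + 1) e
        + 5 * esymmMoment (N + 1) a (b - 1) c d (e + 1))
      + c * (2 * esymmMoment (N + 1) a (b + 1) (c - 1) (d + 1) e
        + 4 * esymmMoment (N + 1) (a + 1) b (c - 1) d (e + 1)
        + 6 * esymmMoment N a b (c - 1) d e)
      + d * (esymmMoment (N + 1) a b (c + 1) d e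
        + 3 * esymmMoment (N + 1) a (b + 1) c (d - 1) (e + 1)
        + 5 * esymmMoment N (a + 1) b c (d - 1) e)
      + e * (2 * esymmMoment (N + 1) a b (c + 1) d e
        + 4 * esymmMoment N a (b + 1) c d (e - 1))
      = 3 * (N + 1) * esymmMoment (N + 1) a b (c + 1) d e := by
  have h1 : esymmField (Fin 6) ℚ 3 (esymm (Fin 6) ℚ 1) =
      4 * esymm (Fin 6) ℚ 4 := by
    rw [esymmField_esymm_one 3]
    norm_num
  have h2 : esymmField (Fin 6) ℚ 3 (esymm (Fin 6) ℚ 2) =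
      3 * (esymm (Fin 6) ℚ 1 * esymm (Fin 6) ℚ 4) + 5 * esymm (Fin 6) ℚ 5 := by
    rw [esymmField_esymm_add_two 3 0, esymmField_esymm_one 4]
    norm_num
    ring
  have h3 : esymmField (Fin 6) ℚ 3 (esymm (Fin 6) ℚ 3) =
      2 * (esymm (Fin 6) ℚ 2 * esymm (Fin 6) ℚ 4) + 4 * (esymm (Fin 6) ℚ 1 * esymm (Fin 6) ℚ 5)
        + 6 * esymm (Fin 6) ℚ 6 := by
    rw [esymmField_esymm_add_two 3 1, esymmField_esymm_add_two 4 0, esymmField_esymm_one 5]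
    norm_num
    ring
  have h4 : esymmField (Fin 6) ℚ 3 (esymm (Fin 6) ℚ 4) =
      (esymm (Fin 6) ℚ 3 * esymm (Fin 6) ℚ 4) + 3 * (esymm (Fin 6) ℚ 2 * esymm (Fin 6) ℚ 5) + 5 *
        (esymm (Fin 6) ℚ 1 * esymm (Fin 6) ℚ 6) := by
    rw [esymmField_esymm_add_two 3 2, esymmField_esymm_add_two 4 1, esymmField_esymm_add_two 5 0,
      esymmField_esymm_one 6]
    norm_num [esymm_eq_zero_of_card_lt (σ := Fin 6) (R := ℚ) (k := 7) (by simp)]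
    ring
  have h5 : esymmField (Fin 6) ℚ 3 (esymm (Fin 6) ℚ 5) =
      2 * (esymm (Fin 6) ℚ 3 * esymm (Fin 6) ℚ 5) + 4 * (esymm (Fin 6) ℚ 2 * esymm
        (Fin 6) ℚ 6) := by
    rw [esymmField_esymm_add_two 3 3, esymmField_esymm_add_two 4 2, esymmField_esymm_add_two 5 1,
      esymmField_esymm_add_two 6 0, esymmField_esymm_one 7]
    norm_num [esymm_eq_zero_of_card_lt (σ := Fin 6) (R := ℚ) (k := 7) (by simp),
      esymm_eq_zero_of_card_lt (σ := Fin 6) (R := ℚ) (k := 8) (by simp)]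
    ring
  have key := coeff_esymmField 3 (N + 1) (esymm (Fin 6) ℚ 1 ^ a * esymm (Fin 6) ℚ 2 ^ b
    * esymm (Fin 6) ℚ 3 ^ c * esymm (Fin 6) ℚ 4 ^ d * esymm (Fin 6) ℚ 5 ^ e)
    (constExponent (N + 1)) fun _ => rfl
  rw [derivation_mul_pow_five, h1, h2, h3, h4, h5] at key
  unfold esymmMoment
  simp only [← coeff_esymm_six_mul N]
  generalize esymm (Fin 6) ℚ 1 = x1 at key ⊢
  generalize esymm (Fin 6) ℚ 2 = x2 at key ⊢
  generalize esymm (Fin 6) ℚ 3 = x3 at key ⊢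
  generalize esymm (Fin 6) ℚ 4 = x4 at key ⊢
  generalize esymm (Fin 6) ℚ 5 = x5 at key ⊢
  generalize esymm (Fin 6) ℚ 6 = x6 at key ⊢
  have hl : x3 * (x1 ^ a * x2 ^ b * x3 ^ c * x4 ^ d * x5 ^ e) =
      x1 ^ a * x2 ^ b * x3 ^ (c + 1) * x4 ^ d * x5 ^ e := by ring
  have hsum :
      (a : MvPolynomial (Fin 6) ℚ) * x1 ^ (a - 1) * (4 * x4) * (x2 ^ b * x3 ^ c * x4 ^ d * x5 ^ e)
        + (b : MvPolynomial (Fin 6) ℚ) * x2 ^ (b - 1) * (3 * (x1 * x4) + 5 * x5) * (x1 ^ a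
          * x3 ^ c * x4 ^ d * x5 ^ e)
        + (c : MvPolynomial (Fin 6) ℚ) * x3 ^ (c - 1) * (2 * (x2 * x4) + 4 * (x1 * x5) + 6 * x6) *
          (x1 ^ a * x2 ^ b * x4 ^ d * x5 ^ e)
        + (d : MvPolynomial (Fin 6) ℚ) * x4 ^ (d - 1) * ((x3 * x4) + 3 * (x2 * x5) + 5 * (x1
          * x6)) * (x1 ^ a * x2 ^ b * x3 ^ c * x5 ^ e)
        + (e : MvPolynomial (Fin 6) ℚ) * x5 ^ (e - 1) * (2 * (x3 * x5) + 4 * (x2 * x6)) * (x1 ^ a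
          * x2 ^ b * x3 ^ c * x4 ^ d)
      = C (4 * (a : ℚ)) * (x1 ^ (a - 1) * x2 ^ b * x3 ^ c * x4 ^ (d + 1) * x5 ^ e)
        + C (3 * (b : ℚ)) * (x1 ^ (a + 1) * x2 ^ (b - 1) * x3 ^ c * x4 ^ (d + 1) * x5 ^ e)
        + C (5 * (b : ℚ)) * (x1 ^ a * x2 ^ (b - 1) * x3 ^ c * x4 ^ d * x5 ^ (e + 1))
        + C (2 * (c : ℚ)) * (x1 ^ a * x2 ^ (b + 1) * x3 ^ (c - 1) * x4 ^ (d + 1) * x5 ^ e)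
        + C (4 * (c : ℚ)) * (x1 ^ (a + 1) * x2 ^ b * x3 ^ (c - 1) * x4 ^ d * x5 ^ (e + 1))
        + C (6 * (c : ℚ)) * x6 * (x1 ^ a * x2 ^ b * x3 ^ (c - 1) * x4 ^ d * x5 ^ e)
        + C (1 * (d : ℚ)) * (x1 ^ a * x2 ^ b * x3 ^ (c + 1) * x4 ^ d * x5 ^ e)
        + C (3 * (d : ℚ)) * (x1 ^ a * x2 ^ (b + 1) * x3 ^ c * x4 ^ (d - 1) * x5 ^ (e + 1))
        + C (5 * (d : ℚ)) * x6 * (x1 ^ (a + 1) * x2 ^ b * x3 ^ c * x4 ^ (d - 1) * x5 ^ e)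
        + C (2 * (e : ℚ)) * (x1 ^ a * x2 ^ b * x3 ^ (c + 1) * x4 ^ d * x5 ^ e)
        + C (4 * (e : ℚ)) * x6 * (x1 ^ a * x2 ^ (b + 1) * x3 ^ c * x4 ^ d * x5 ^ (e - 1)) := by
    simp only [map_mul, map_natCast, map_ofNat, map_one]
    linear_combination x3 * (x1 ^ a * x2 ^ b * x3 ^ c * x5 ^ e) * natCast_mul_pow_pred_mul x4 d
      + 2 * x3 * (x1 ^ a * x2 ^ b * x3 ^ c * x4 ^ d) * natCast_mul_pow_pred_mul x5 e
  rw [hsum, hl] at key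
  simp only [coeff_add, coeff_C_mul, mul_assoc (C _)] at key
  simp at key
  linear_combination key

/-! ### Reversal symmetry of moments. -/

/-- Pairs of polynomials that are exchanged by the reversal `x ^ κ ↦ x ^ (K - κ)`. -/
noncomputable def reversePairs (K : ℕ) :
    Submodule ℚ (MvPolynomial (Fin 6) ℚ × MvPolynomial (Fin 6) ℚ) :=
  Submodule.span ℚ {p | ∃ κ κ' : Fin 6 →₀ ℕ, κ + κ' = constExponent K ∧
    p = (monomial κ 1, monomial κ' 1)}

theorem constExponent_add (K L : ℕ) :
    constExponent (K + L) = constExponent K + constExponent L := by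
  ext i; simp

/-- Reversal is handled through its graph: the graphs for K and L multiply into the one for K + L,
with no negative exponents needed. -/
theorem mul_mem_reversePairs {K L : ℕ} {p q : MvPolynomial (Fin 6) ℚ × MvPolynomial (Fin 6) ℚ}
    (hp : p ∈ reversePairs K) (hq : q ∈ reversePairs L) : p * q ∈ reversePairs (K + L) := by
  have h := Submodule.mul_mem_mul hp hq
  rw [reversePairs, reversePairs, Submodule.span_mul_span] at h
  refine Submodule.span_mono ?_ h
  rintro _ ⟨_, ⟨κ, κ', hκ, rfl⟩, _, ⟨μ, μ', hμ, rfl⟩, rfl⟩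
  refine ⟨κ + μ, κ' + μ', ?_, ?_⟩
  · rw [constExponent_add, ← hκ, ← hμ]; abel
  · simp [monomial_mul]

theorem one_mem_reversePairs : 1 ∈ reversePairs 0 :=
  Submodule.subset_span ⟨0, 0, by ext; simp, rfl⟩

theorem pow_mem_reversePairs {p : MvPolynomial (Fin 6) ℚ × MvPolynomial (Fin 6) ℚ}
    (hp : p ∈ reversePairs 1) (k : ℕ) : p ^ k ∈ reversePairs k := by
  induction k with
  | zero => simpa using one_mem_reversePairs
  | succ k ih => rw [pow_succ]; exact mul_mem_reversePairs ih hp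

theorem coeff_eq_of_mem_reversePairs {K : ℕ}
    {p : MvPolynomial (Fin 6) ℚ × MvPolynomial (Fin 6) ℚ} (hp : p ∈ reversePairs K)
    {κ κ' : Fin 6 →₀ ℕ} (h : κ + κ' = constExponent K) : coeff κ p.1 = coeff κ' p.2 := by
  induction hp using Submodule.span_induction with
  | mem p hp =>
    obtain ⟨μ, μ', hμ, rfl⟩ := hp
    have h1 : μ = κ ↔ μ' = κ' := by
      constructor
      · rintro rfl; exact add_left_cancel (hμ.trans h.symm)
      · rintro rfl; exact add_right_cancel (hμ.trans h.symm)
    simp only [coeff_monomial, h1]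
  | zero => simp
  | add p q _ _ hp hq => simp [hp, hq]
  | smul r p _ hp => simp [hp]

/-- Complementation of subsets matches the terms of eⱼ with those of e₆₋ⱼ. -/
theorem esymm_mem_reversePairs {j k : ℕ} (h : j + k = 6) :
    (esymm (Fin 6) ℚ j, esymm (Fin 6) ℚ k) ∈ reversePairs 1 := by
  have hsum : (esymm (Fin 6) ℚ j, esymm (Fin 6) ℚ k)
      = ∑ t ∈ powersetCard j (univ : Finset (Fin 6)), (monomial (∑ i ∈ t, Finsupp.single i 1)
        (1 : ℚ),
          monomial (∑ i ∈ tᶜ, Finsupp.single i 1) (1 : ℚ)) := by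
    ext1
    · rw [Prod.fst_sum, esymm_eq_sum_monomial]
    · rw [Prod.snd_sum]
      dsimp only
      rw [esymm_eq_sum_monomial]
      refine sum_nbij' (fun t => tᶜ) (fun t => tᶜ) ?_ ?_ ?_ ?_ ?_
      · intro t ht
        simp only [mem_powersetCard_univ, card_compl, Fintype.card_fin] at ht ⊢
        omega
      · intro t ht
        simp only [mem_powersetCard_univ, card_compl, Fintype.card_fin] at ht ⊢
        omega
      · simp
      · simp
      · simp
  rw [hsum]
  refine Submodule.sum_mem _ fun t _ => Submodule.subset_span ⟨_, _, ?_, rfl⟩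
  rw [sum_add_sum_compl]
  ext i
  simp [Finsupp.finsetSum_apply, Finsupp.single_apply]

/-- The symmetry of moments under `xᵢ ↦ xᵢ⁻¹`. -/
theorem esymmMoment_reverse {N N' a b c d e : ℕ} (h : N + N' = a + b + c + d + e) :
    esymmMoment N a b c d e = esymmMoment N' e d c b a := by
  have hp := mul_mem_reversePairs (mul_mem_reversePairs (mul_mem_reversePairs
    (mul_mem_reversePairs (pow_mem_reversePairs (esymm_mem_reversePairs (j := 1) (k := 5) rfl) a)
    (pow_mem_reversePairs (esymm_mem_reversePairs (j := 2) (k := 4) rfl) b))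
    (pow_mem_reversePairs (esymm_mem_reversePairs (j := 3) (k := 3) rfl) c))
    (pow_mem_reversePairs (esymm_mem_reversePairs (j := 4) (k := 2) rfl) d))
    (pow_mem_reversePairs (esymm_mem_reversePairs (j := 5) (k := 1) rfl) e)
  have hκ : constExponent N + constExponent N' = constExponent (a + b + c + d + e) := by
    rw [← constExponent_add, h]
  have h1 := coeff_eq_of_mem_reversePairs hp hκ
  simp only [Prod.pow_mk, Prod.mk_mul_mk] at h1
  rw [esymmMoment, esymmMoment, h1]
  congr 1
  ring

/-! ### Balanced matrices as coefficients. -/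

theorem coeff_esymm_pow (k m : ℕ) (κ : Fin (2 * k) →₀ ℕ) :
    coeff κ (esymm (Fin (2 * k)) ℚ k ^ m)
      = #{f ∈ Fintype.piFinset fun _ : Fin m => powersetCard k (univ : Finset (Fin (2 * k))) |
          ∀ i, #{j | i ∈ f j} = κ i} := by
  have h : esymm (Fin (2 * k)) ℚ k ^ m
      = ∏ _j : Fin m, ∑ t ∈ powersetCard k univ, monomial (∑ i ∈ t, Finsupp.single i 1) 1 := by
    rw [← esymm_eq_sum_monomial, prod_const, card_univ, Fintype.card_fin]
  rw [h, prod_univ_sum, coeff_sum, natCast_card_filter]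
  refine sum_congr rfl fun f _ => ?_
  rw [← monomial_sum_one, coeff_monomial]
  refine if_congr ?_ rfl rfl
  rw [Finsupp.ext_iff]
  refine forall_congr' fun i => ?_
  rw [Finsupp.finsetSum_apply, card_filter]
  simp [Finsupp.finsetSum_apply, Finsupp.single_apply]

end MvPolynomial

-- Each factor eₖ chooses the set of ones of a column; the exponent of xᵢ in the product is the
-- number of ones in row i.
open MvPolynomial Finset in
theorem balancedCount_eq_coeff (k n : ℕ) (κ : Fin (2 * k) →₀ ℕ) (hκ : ∀ i, κ i = n) :
    (balancedCount k n : ℚ) = coeff κ (esymm (Fin (2 * k)) ℚ k ^ (2 * n)) := by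
  rw [coeff_esymm_pow, balancedCount]
  simp only [hκ]
  classical
  rw [Nat.subtype_card {A | IsBalanced k n A} (by simp), Nat.cast_inj]
  refine card_nbij' (fun A j => {i | A i j = 1}) (fun f => .of fun i j => if i ∈ f j then 1 else 0)
    ?_ ?_ ?_ ?_
  · intro A hA
    rw [mem_coe, mem_filter] at hA
    simpa [IsBalanced, and_comm] using hA
  · intro f hf
    rw [mem_coe, mem_filter]
    simpa [IsBalanced, and_comm] using hf
  · intro A _
    ext i j
    rcases Fin.exists_fin_two.1 ⟨A i j, rfl⟩ with h | h <;> simp [h]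
  · intro f _
    ext j i
    simp

/-! ### Linear algebra of the relations. -/

/-- Elimination of the auxiliary moments from the linear relations among them. -/
theorem moment_elimination {x A X Y Z A' X' Y' Z' U V G H K T W Q S p q q' r s t : ℚ}
    (hx : 0 ≤ x)
    (h0 : (3 + 3 * x) * A' = (2 + 4 * x) * Y + (4 + 8 * x) * X + (6 + 12 * x) * A)
    (h1 : (2 + x) * U = 3 * A' + (4 + 8 * x) * Y)
    (h2 : (2 + x) * X' = (8 + 8 * x) * U + 6 * A')
    (h3 : (2 + x) * V = (4 + 8 * x) * Z + 10 * U)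
    (h4 : (4 + 2 * x) * Y' = (6 + 6 * x) * V + (10 + 10 * x) * U + 4 * X' + 6 * A')
    (h5 : (2 + 2 * x) * Y = 6 * x * t + 10 * x * s + 4 * X + 6 * A)
    (h6 : (1 + x) * X = 8 * x * s + 6 * A)
    (h7 : (2 + x) * G = 2 * Y + 8 * x * t + 5 * X)
    (h8 : (4 + 2 * x) * V = 2 * X' + 9 * U + (3 + 6 * x) * H + (5 + 10 * x) * G)
    (h9 : (4 + 3 * x) * X' = 8 * U + (2 + 4 * x) * H + (4 + 8 * x) * K + (6 + 12 * x) * X)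
    (h10 : (3 + 2 * x) * H = 3 * U + 6 * x * q + 10 * x * r + 4 * K + 6 * X + 5 * G)
    (h11 : (4 + 3 * x) * V = 4 * Z + 4 * x * q' + 8 * x * q + 12 * x * t + 6 * H + 10 * G)
    (h12 : (3 + 3 * x) * U = 4 * x * p + 8 * x * r + 12 * x * s + 3 * G + 5 * X + 4 * Y)
    (h13 : (4 + 2 * x) * T = 2 * V + 4 * Z + 6 * x * q' + 10 * x * p + 8 * H + 12 * Y)
    (h14 : (3 + x) * W = 6 * Y' + (4 + 8 * x) * T + 5 * V)
    (h15 : (6 + 2 * x) * Z' = 4 * Q + 8 * Y' + (6 + 6 * x) * W + (10 + 10 * x) * V)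
    (h16 : (3 + x) * Q = 3 * S + (12 + 8 * x) * Y')
    (hS : (6 + 3 * x) * S = (6 + 4 * x) * Y' + (12 + 8 * x) * X' + (18 + 12 * x) * A') :
    A' = 2 * (2 * x + 1) / (3 * (x + 1)) * (Y + 2 * X + 3 * A) ∧
    X' = 4 * (2 * x + 1) / ((x + 2) ^ 2 * (x + 1)) *
      ((8 * x ^ 2 + 21 * x + 14) * Y + (5 * x + 6) * (2 * X + 3 * A)) ∧
    Y' = 2 * (2 * x + 1) / ((x + 2) ^ 3 * (x + 1)) *
      ((10 * x ^ 3 + 138 * x ^ 2 + 303 * x + 180) * Y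
        + (6 * x ^ 2 + 69 * x + 68) * (2 * X + 3 * A) + 6 * (x + 2) * (x + 1) ^ 2 * Z) ∧
    Z' = 4 * (2 * x + 1) / (3 * (x + 3) ^ 2 * (x + 2) ^ 4 * (x + 1)) *
      ((323 * x ^ 6 + 6156 * x ^ 5 + 39753 * x ^ 4 + 121548 * x ^ 3 + 192246 * x ^ 2
        + 152166 * x + 47728) * Y
      + 2 * (-25 * x ^ 6 - 68 * x ^ 5 + 2201 * x ^ 4 + 15688 * x ^ 3 + 40442 * x ^ 2
        + 44962 * x + 18144) * X
      + 6 * (91 * x ^ 5 + 1613 * x ^ 4 + 8944 * x ^ 3 + 21521 * x ^ 2 + 23281 * x + 9272) * A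
      + 3 * (x + 1) ^ 2 * (x + 2) * (43 * x ^ 3 + 284 * x ^ 2 + 596 * x + 388) * Z) := by
  have e0 : x + 1 ≠ 0 := by positivity
  have e1 : 2 + x ≠ 0 := by positivity
  have e2 : 1 + 2 * x ≠ 0 := by positivity
  have e3 : 3 + x ≠ 0 := by positivity
  have e4 : x + 2 ≠ 0 := by positivity
  have e5 : x + 3 ≠ 0 := by positivity
  -- The multipliers are chosen to cancel p, q, q', r, s and t. These unknowns carry a factor x
  -- throughout, so cancelling them avoids a division by x, which may be 0.
  have hT : (4 + 2 * x) * T = 2 * V + 4 * Z + 8 * H + 12 * Y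
      + 5 / 2 * ((3 + 3 * x) * U - 3 * G - 5 * X - 4 * Y)
      + 3 / 2 * ((4 + 3 * x) * V - 4 * Z - 6 * H - 10 * G)
      - 3 * ((2 + 2 * x) * Y - 4 * X - 6 * A)
      - 2 * ((3 + 2 * x) * H - 3 * U - 4 * K - 6 * X - 5 * G) := by
    linear_combination h13 - 5 / 2 * h12 - 3 / 2 * h11 + 2 * h10 + 3 * h5
  have hG : (2 + x) * G = 2 * Y + 4 / 3 * ((2 + 2 * x) * Y - 4 * X - 6 * A
      - 5 / 4 * ((1 + x) * X - 6 * A)) + 5 * X := by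
    linear_combination h7 - 4 / 3 * h5 + 5 / 3 * h6
  have hH : 3 * (1 + 2 * x) * H = (4 + 2 * x) * V - 2 * X' - 9 * U - (5 + 10 * x) * G := by
    linear_combination -h8
  have hK : 4 * (1 + 2 * x) * K
      = (4 + 3 * x) * X' - 8 * U - (2 + 4 * x) * H - (6 + 12 * x) * X := by
    linear_combination -h9
  clear h5 h6 h7 h8 h9 h10 h11 h12 h13
  -- The system is now triangular: each relation has one new unknown, whose closed form in A, X, Y,
  -- Z is checked after multiplying by its coefficient, nonzero as x ≥ 0.
  obtain rfl : A' = 2 * (2 * x + 1) / (3 * (x + 1)) * (Y + 2 * X + 3 * A) := by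
    field_simp; linear_combination h0
  obtain rfl : U = 2 * (2 * x + 1) / ((x + 2) * (x + 1)) * ((2 * x + 3) * Y + 2 * X + 3 * A) := by
    refine mul_left_cancel₀ e1 (h1.trans ?_); field_simp; ring
  obtain rfl : X' = 4 * (2 * x + 1) / ((x + 2) ^ 2 * (x + 1)) *
      ((8 * x ^ 2 + 21 * x + 14) * Y + (5 * x + 6) * (2 * X + 3 * A)) := by
    refine mul_left_cancel₀ e1 (h2.trans ?_); field_simp; ring
  obtain rfl : V = 4 * (2 * x + 1) / ((x + 2) ^ 2 * (x + 1)) *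
      (5 * ((2 * x + 3) * Y + 2 * X + 3 * A) + (x + 2) * (x + 1) * Z) := by
    refine mul_left_cancel₀ e1 (h3.trans ?_); field_simp; ring
  obtain rfl : Y' = 2 * (2 * x + 1) / ((x + 2) ^ 3 * (x + 1)) *
      ((10 * x ^ 3 + 138 * x ^ 2 + 303 * x + 180) * Y
        + (6 * x ^ 2 + 69 * x + 68) * (2 * X + 3 * A) + 6 * (x + 2) * (x + 1) ^ 2 * Z) := by
    refine mul_left_cancel₀ (mul_ne_zero two_ne_zero e1) (Eq.trans ?_ (h4.trans ?_))
    · ring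
    · field_simp; ring
  obtain rfl : G = ((8 * x + 14) * Y - (5 * x + 6) * X + 6 * A) / (3 * (x + 2)) := by
    refine mul_left_cancel₀ e1 (hG.trans ?_); field_simp; ring
  obtain rfl : H = (2 * (-20 * x ^ 3 - 125 * x ^ 2 - 166 * x - 40) * Y
      + (25 * x ^ 3 + 105 * x ^ 2 + 32 * x + 36) * X
      - 6 * (x + 8) * (5 * x + 2) * A + 24 * (x + 2) ^ 2 * (x + 1) * Z)
      / (9 * (x + 2) ^ 2 * (x + 1)) := by
    refine mul_left_cancel₀ (mul_ne_zero three_ne_zero e2) (hH.trans ?_)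
    field_simp; ring
  obtain rfl : K = (2 * (59 * x ^ 3 + 227 * x ^ 2 + 262 * x + 82) * Y
      + (-13 * x ^ 3 + 75 * x ^ 2 + 244 * x + 108) * X
      + 6 * (35 * x ^ 2 + 87 * x + 40) * A - 6 * (x + 2) ^ 2 * (x + 1) * Z) * 2
      / (9 * (x + 2) ^ 2 * (x + 1)) := by
    refine mul_left_cancel₀ (mul_ne_zero four_ne_zero e2) (hK.trans ?_)
    field_simp; ring
  obtain rfl : T = ((323 * x ^ 4 + 4467 * x ^ 3 + 13499 * x ^ 2 + 13863 * x + 3884) * Y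
      + 2 * (-25 * x ^ 4 + 7 * x ^ 3 + 1801 * x ^ 2 + 3941 * x + 1548) * X
      + 3 * (182 * x ^ 3 + 2251 * x ^ 2 + 4441 * x + 1748) * A
      + 6 * (19 * x ^ 2 + 22 * x - 23) * (x + 2) * (x + 1) * Z) / (9 * (x + 2) ^ 3 * (x + 1)) := by
    refine mul_left_cancel₀ (mul_ne_zero two_ne_zero e1) (Eq.trans ?_ (hT.trans ?_))
    · ring
    · field_simp; ring
  obtain rfl : W = 4 * (2 * x + 1) *
      ((323 * x ^ 4 + 4737 * x ^ 3 + 17675 * x ^ 2 + 23619 * x + 10094) * Y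
      + 2 * (-25 * x ^ 4 + 7 * x ^ 3 + 1963 * x ^ 2 + 6029 * x + 3834) * X
      + 3 * (182 * x ^ 3 + 2413 * x ^ 2 + 6529 * x + 4034) * A
      + 3 * (38 * x ^ 2 + 113 * x + 38) * (x + 2) * (x + 1) * Z)
      / (9 * (x + 3) * (x + 2) ^ 3 * (x + 1)) := by
    refine mul_left_cancel₀ e3 (h14.trans ?_); field_simp; ring
  obtain rfl : S = 4 * (2 * x + 3) * (2 * x + 1) / (3 * (x + 2) ^ 4 * (x + 1)) *
      ((43 * x ^ 3 + 292 * x ^ 2 + 539 * x + 300) * Y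
      + (x ^ 3 + 32 * x ^ 2 + 145 * x + 124) * (2 * X + 3 * A)
      + 6 * (x + 1) ^ 2 * (x + 2) * Z) := by
    refine mul_left_cancel₀ (mul_ne_zero three_ne_zero e1) (Eq.trans ?_ (hS.trans ?_))
    · ring
    · field_simp; ring
  obtain rfl : Q = 4 * (2 * x + 3) * (2 * x + 1) / ((x + 3) * (x + 2) ^ 4 * (x + 1)) *
      ((20 * x ^ 4 + 359 * x ^ 3 + 1450 * x ^ 2 + 2111 * x + 1020) * Y
      + (13 * x ^ 3 + 194 * x ^ 2 + 557 * x + 396) * (2 * X + 3 * A)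
      + 6 * (x + 1) ^ 2 * (2 * x + 5) * (x + 2) * Z) := by
    refine mul_left_cancel₀ e3 (h16.trans ?_); field_simp; ring
  refine ⟨rfl, rfl, rfl, ?_⟩
  refine mul_left_cancel₀ (mul_ne_zero two_ne_zero e3) (Eq.trans ?_ (h15.trans ?_))
  · ring
  · field_simp; ring

/-! ### The four moments and their transition from n to n + 1. -/

namespace MvPolynomial

/-- The coefficient of `(x₁ ⋯ x₆) ^ n` in `e₃ ^ (2 * n)`. -/
noncomputable def cubicMoment (n : ℕ) : ℚ := esymmMoment n 0 0 (2 * n) 0 0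

/-- The coefficient of `(x₁ ⋯ x₆) ^ (n + 1)` in `e₁ * e₃ ^ (2 * n) * e₅`. -/
noncomputable def cubicMomentOneFive (n : ℕ) : ℚ := esymmMoment (n + 1) 1 0 (2 * n) 0 1

/-- The coefficient of `(x₁ ⋯ x₆) ^ (n + 1)` in `e₂ * e₃ ^ (2 * n) * e₄`. -/
noncomputable def cubicMomentTwoFour (n : ℕ) : ℚ := esymmMoment (n + 1) 0 1 (2 * n) 1 0

/-- The coefficient of `(x₁ ⋯ x₆) ^ (n + 2)` in `e₃ ^ (2 * n) * e₄ ^ 3`. -/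
noncomputable def cubicMomentFourCubed (n : ℕ) : ℚ := esymmMoment (n + 2) 0 0 (2 * n) 3 0

/-- The four moments at `n + 1` are linear combinations of those at `n`. -/
theorem cubicMoment_transition (n : ℕ) :
    cubicMoment (n + 1) = 2 * (2 * (n : ℚ) + 1) / (3 * (n + 1)) *
      (cubicMomentTwoFour n + 2 * cubicMomentOneFive n + 3 * cubicMoment n) ∧
    cubicMomentOneFive (n + 1) = 4 * (2 * (n : ℚ) + 1) / ((n + 2) ^ 2 * (n + 1)) *
      ((8 * n ^ 2 + 21 * n + 14) * cubicMomentTwoFour n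
        + (5 * n + 6) * (2 * cubicMomentOneFive n + 3 * cubicMoment n)) ∧
    cubicMomentTwoFour (n + 1) = 2 * (2 * (n : ℚ) + 1) / ((n + 2) ^ 3 * (n + 1)) *
      ((10 * n ^ 3 + 138 * n ^ 2 + 303 * n + 180) * cubicMomentTwoFour n
        + (6 * n ^ 2 + 69 * n + 68) * (2 * cubicMomentOneFive n + 3 * cubicMoment n)
        + 6 * (n + 2) * (n + 1) ^ 2 * cubicMomentFourCubed n) ∧
    cubicMomentFourCubed (n + 1) =
      4 * (2 * (n : ℚ) + 1) / (3 * (n + 3) ^ 2 * (n + 2) ^ 4 * (n + 1)) *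
      ((323 * n ^ 6 + 6156 * n ^ 5 + 39753 * n ^ 4 + 121548 * n ^ 3 + 192246 * n ^ 2 + 152166 * n
        + 47728) * cubicMomentTwoFour n
      + 2 * (-25 * n ^ 6 - 68 * n ^ 5 + 2201 * n ^ 4 + 15688 * n ^ 3 + 40442 * n ^ 2 + 44962 * n
        + 18144) * cubicMomentOneFive n
      + 6 * (91 * n ^ 5 + 1613 * n ^ 4 + 8944 * n ^ 3 + 21521 * n ^ 2 + 23281 * n + 9272)
        * cubicMoment n
      + 3 * (n + 1) ^ 2 * (n + 2) * (43 * n ^ 3 + 284 * n ^ 2 + 596 * n + 388)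
        * cubicMomentFourCubed n) := by
  have h0 := esymmMoment_field_three n 0 0 (2 * n + 1) 0 0
  have h1 := esymmMoment_field_one n 0 1 (2 * n + 1) 0 0
  have h2 := esymmMoment_field_one (n + 1) 0 0 (2 * n + 2) 0 1
  have h3 := esymmMoment_field_one (n + 1) 0 0 (2 * n + 1) 2 0
  have h4 := esymmMoment_field_two (n + 1) 0 0 (2 * n + 2) 1 0
  have h5 := esymmMoment_field_two n 0 0 (2 * n) 1 0
  have h6 := esymmMoment_field_one n 0 0 (2 * n) 0 1
  have h7 := esymmMoment_field_one n 1 0 (2 * n) 1 0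
  have h8 := esymmMoment_field_two (n + 1) 0 1 (2 * n + 1) 0 1
  have h9 := esymmMoment_field_three (n + 1) 1 0 (2 * n + 1) 0 1
  have h10 := esymmMoment_field_two (n + 1) 1 0 (2 * n) 1 1
  have h11 := esymmMoment_field_three (n + 1) 1 0 (2 * n) 2 0
  have h12 := esymmMoment_field_three (n + 1) 0 0 (2 * n) 1 1
  have h13 := esymmMoment_field_two (n + 1) 0 1 (2 * n) 2 0
  have h14 := esymmMoment_field_one (n + 1) 0 2 (2 * n + 1) 1 0
  have h15 := esymmMoment_field_two (n + 1) 0 2 (2 * n + 2) 0 0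
  have h16 := esymmMoment_field_one (n + 1) 0 1 (2 * n + 3) 0 0
  have hS := esymmMoment_field_three (n + 1) 0 0 (2 * n + 3) 0 0
  norm_num at h0 h1 h2 h3 h4 h5 h6 h7 h8 h9 h10 h11 h12 h13 h14 h15 h16 hS
  -- Reversal identifies four moments with their mirror images U, V, Z' and G, reducing the number
  -- of unknowns.
  rw [esymmMoment_reverse (N' := n + 2) (by omega : _ = 1 + 1 + (2 * n + 1) + 0 + 0)] at h1 h8 h9
  rw [esymmMoment_reverse (N' := n + 2) (by omega : _ = 0 + 2 + (2 * n + 1) + 0 + 1)] at h14 h15 h8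
  rw [esymmMoment_reverse (N' := n + 3) (by omega : _ = 0 + 3 + (2 * n + 2) + 0 + 0)] at h15
  rw [esymmMoment_reverse (N' := n + 1) (by omega : _ = 0 + 1 + 2 * n + 0 + 2)] at h8 h12
  refine moment_elimination (x := n)
    (U := esymmMoment (n + 2) 0 0 (2 * n + 1) 1 1)
    (V := esymmMoment (n + 2) 1 0 (2 * n + 1) 2 0)
    (G := esymmMoment (n + 1) 2 0 (2 * n) 1 0)
    (H := esymmMoment (n + 2) 1 1 (2 * n) 1 1)
    (K := esymmMoment (n + 2) 2 0 (2 * n) 0 2)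
    (T := esymmMoment (n + 2) 0 2 (2 * n) 2 0)
    (W := esymmMoment (n + 2) 1 2 (2 * n + 1) 1 0)
    (Q := esymmMoment (n + 2) 1 1 (2 * n + 3) 0 0)
    (S := esymmMoment (n + 2) 0 0 (2 * n + 4) 0 0)
    -- For n = 0 the exponent 2n − 1 truncates to 0, but these moments occur only multiplied by n.
    (p := esymmMoment (n + 2) 0 1 (2 * n - 1) 2 1)
    (q := esymmMoment (n + 2) 2 0 (2 * n - 1) 2 1)
    (r := esymmMoment (n + 2) 1 0 (2 * n - 1) 1 2)
    (s := esymmMoment (n + 1) 0 0 (2 * n - 1) 1 1)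
    (t := esymmMoment (n + 1) 1 0 (2 * n - 1) 2 0)
    (q' := esymmMoment (n + 2) 1 1 (2 * n - 1) 3 0)
    n.cast_nonneg ?_ ?_ ?_ ?_ ?_ ?_ ?_ ?_ ?_ ?_ ?_ ?_ ?_ ?_ ?_ ?_ ?_ ?_ <;>
  simp only [cubicMoment, cubicMomentOneFive, cubicMomentTwoFour, cubicMomentFourCubed, mul_add,
    mul_one]
  · linear_combination -h0
  · linear_combination -h1
  · linear_combination -h2
  · linear_combination -h3
  · linear_combination -h4
  · linear_combination -h5
  · linear_combination -h6
  · linear_combination -h7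
  · linear_combination -h8
  · linear_combination -h9
  · linear_combination -h10
  · linear_combination -h11
  · linear_combination -h12
  · linear_combination -h13
  · linear_combination -h14
  · linear_combination -h15
  · linear_combination -h16
  · linear_combination -hS

end MvPolynomial

/-! ### The recurrence. -/

open MvPolynomial

theorem cubicMoment_recurrence (n : ℕ) :
    51200 * (2 * (n : ℚ) + 7) * (2 * (n : ℚ) + 5) * (2 * (n : ℚ) + 3) * (2 * (n : ℚ) + 1)
          * ((n : ℚ) + 2) * ((n : ℚ) + 1)
          * (33 * (n : ℚ) ^ 2 + 242 * (n : ℚ) + 445) * cubicMoment n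
      - 128 * (2 * (n : ℚ) + 7) * (2 * (n : ℚ) + 5) * (2 * (n : ℚ) + 3) * ((n : ℚ) + 2)
          * (7491 * (n : ℚ) ^ 4 + 84898 * (n : ℚ) ^ 3 + 351364 * (n : ℚ) ^ 2
              + 628997 * (n : ℚ) + 414370) * cubicMoment (n + 1)
      + 16 * (2 * (n : ℚ) + 5) * (2 * (n : ℚ) + 7)
          * (2772 * (n : ℚ) ^ 6 + 48048 * (n : ℚ) ^ 5 + 344379 * (n : ℚ) ^ 4
              + 1307394 * (n : ℚ) ^ 3 + 2775099 * (n : ℚ) ^ 2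
              + 3125336 * (n : ℚ) + 1460132) * cubicMoment (n + 2)
      + 2 * (2 * (n : ℚ) + 7) * ((n : ℚ) + 3)
          * (3201 * (n : ℚ) ^ 6 + 61886 * (n : ℚ) ^ 5 + 497179 * (n : ℚ) ^ 4
              + 2124170 * (n : ℚ) ^ 3 + 5089654 * (n : ℚ) ^ 2
              + 6484024 * (n : ℚ) + 3431096) * cubicMoment (n + 3)
      - ((n : ℚ) + 3) * ((n : ℚ) + 4) ^ 5
          * (33 * (n : ℚ) ^ 2 + 176 * (n : ℚ) + 236) * cubicMoment (n + 4) = 0 := by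
  obtain ⟨a0, x0, y0, z0⟩ := cubicMoment_transition n
  obtain ⟨a1, x1, y1, z1⟩ := cubicMoment_transition (n + 1)
  -- The e₄³ moment enters the e₃ moment only two steps later, through the e₂e₄ moment, so its value
  -- at n + 3 is not needed for `cubicMoment (n + 4)`.
  obtain ⟨a2, x2, y2, -⟩ := cubicMoment_transition (n + 2)
  obtain ⟨a3, -, -, -⟩ := cubicMoment_transition (n + 3)
  push_cast at *
  simp only [add_assoc, Nat.reduceAdd] at *
  generalize cubicMoment (n + 4) = A4 at *
  generalize cubicMoment (n + 3) = A3 at *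
  generalize cubicMoment (n + 2) = A2 at *
  generalize cubicMoment (n + 1) = A1 at *
  generalize cubicMomentOneFive (n + 3) = X3 at *
  generalize cubicMomentOneFive (n + 2) = X2 at *
  generalize cubicMomentOneFive (n + 1) = X1 at *
  generalize cubicMomentTwoFour (n + 3) = Y3 at *
  generalize cubicMomentTwoFour (n + 2) = Y2 at *
  generalize cubicMomentTwoFour (n + 1) = Y1 at *
  generalize cubicMomentFourCubed (n + 2) = Z2 at *
  generalize cubicMomentFourCubed (n + 1) = Z1 at *
  generalize cubicMoment n = A at *
  generalize cubicMomentOneFive n = X at *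
  generalize cubicMomentTwoFour n = Y at *
  generalize cubicMomentFourCubed n = Z at *
  have hx : (0 : ℚ) ≤ n := n.cast_nonneg
  generalize (n : ℚ) = x at *
  have e1 : x + 1 ≠ 0 := by positivity
  have e2 : x + 2 ≠ 0 := by positivity
  have e3 : x + 3 ≠ 0 := by positivity
  have e4 : x + 4 ≠ 0 := by positivity
  norm_num [add_assoc] at *
  -- Substitution runs from the latest index back to n, leaving an identity linear in A, X, Y, Z
  -- with coefficients rational in x.
  subst a3 y2 x2 a2 z1 y1 x1 a1
  subst z0 y0 x0 a0
  field_simp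
  ring

theorem theorem5 (a : ℕ → ℤ) (ha : ∀ n : ℕ, a n = (balancedCount 3 n : ℤ)) (n : ℕ) :
    51200 * (2 * (n : ℤ) + 7) * (2 * (n : ℤ) + 5) * (2 * (n : ℤ) + 3) * (2 * (n : ℤ) + 1)
          * ((n : ℤ) + 2) * ((n : ℤ) + 1)
          * (33 * (n : ℤ) ^ 2 + 242 * (n : ℤ) + 445) * a n
      - 128 * (2 * (n : ℤ) + 7) * (2 * (n : ℤ) + 5) * (2 * (n : ℤ) + 3) * ((n : ℤ) + 2)
          * (7491 * (n : ℤ) ^ 4 + 84898 * (n : ℤ) ^ 3 + 351364 * (n : ℤ) ^ 2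
              + 628997 * (n : ℤ) + 414370) * a (n + 1)
      + 16 * (2 * (n : ℤ) + 5) * (2 * (n : ℤ) + 7)
          * (2772 * (n : ℤ) ^ 6 + 48048 * (n : ℤ) ^ 5 + 344379 * (n : ℤ) ^ 4
              + 1307394 * (n : ℤ) ^ 3 + 2775099 * (n : ℤ) ^ 2
              + 3125336 * (n : ℤ) + 1460132) * a (n + 2)
      + 2 * (2 * (n : ℤ) + 7) * ((n : ℤ) + 3)
          * (3201 * (n : ℤ) ^ 6 + 61886 * (n : ℤ) ^ 5 + 497179 * (n : ℤ) ^ 4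
              + 2124170 * (n : ℤ) ^ 3 + 5089654 * (n : ℤ) ^ 2
              + 6484024 * (n : ℤ) + 3431096) * a (n + 3)
      - ((n : ℤ) + 3) * ((n : ℤ) + 4) ^ 5
          * (33 * (n : ℤ) ^ 2 + 176 * (n : ℤ) + 236) * a (n + 4) = 0 := by
  have h : ∀ m, (a m : ℚ) = cubicMoment m := fun m => by
    rw [ha, Int.cast_natCast, balancedCount_eq_coeff 3 m (constExponent m) fun _ => rfl]
    simp [cubicMoment, esymmMoment]
  have hr := cubicMoment_recurrence n
  simp only [← h] at hr
  exact_mod_cast hr
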